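/- Let $\mathbb F_q$ be a finite field and let $\ell$, $n_1,\dots,n_\ell$, $m_1\ge\dots\ge m_\ell$ be positive integers with $n_i\le m_i$ for all $i$. Put $n=n_1+\dots+n_\ell$ and $\mathbb M=\mathbb F_q^{m_1\times n_1}\times\dots\times\mathbb F_q^{m_\ell\times n_\ell}$. For $X=(X_1,\dots,X_\ell)\in\mathbb M$ let $\mathrm{srk}(X)=\sum_i\mathrm{rk}(X_i)$. For a linear subspace $\mathcal A\subseteq\mathbb M$ let $\mathrm{maxsrk}(\mathcal A)=\max_{X\in\mathcal A}\mathrm{srk}(X)$. A linear subspace $\mathcal A_i\subseteq\mathbb F_q^{m_i\times n_i}$ is an optimal anticode if $\dim\mathcal A_i=m_i\max_{X\in\mathcal A_i}\mathrm{rk}(X)$. Let $\mathcal P$ be the set of all products $\mathcal A=\mathcal A_1\times\dots\times\mathcal A_\ell\subseteq\mathbb M$ of optimal anticodes $\mathcal A_i\subseteq\mathbb F_q^{m_i\times n_i}$. A code is a linear subspace $\mathcal C\subseteq\mathbb M$; it is non-trivial if $\mathcal C\ne0,\mathbb M$. For $1\le r\le\dim\mathcal C$, its $r$-th generalized weight is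 $$d_r(\mathcal C)=\min\{\mathrm{maxsrk}(\mathcal A):\ \mathcal A\in\mathcal P,\ \dim(\mathcal C\cap\mathcal A)\ge r\}.$$ For $0\le\mu\le n$ let $r_\mu=\max\{\dim\mathcal A:\ \mathcal A\in\mathcal P,\ \mathrm{maxsrk}(\mathcal A)=\mu\}$. For $1\le h\le n$ let $k(h)=\max\{\nu\in\{1,\dots,\ell\}:\ \sum_{i=1}^{\nu-1}n_i<h\}$. Let $\mathcal C$ be a code with $\dim\mathcal C=\sum_{i=j}^{\ell}m_in_i-\delta m_j$ for some $1\le j\le\ell$ and $0\le\delta\le n_j-1$, and put $d_{\max}=\sum_{i=1}^{j-1}n_i+\delta+1$. An integer $r$ is said to be attached to $h$, where $d_{\max}\le h\le n$, if $$r=r_h-r_{d_{\max}-1}-m_{k(h)}+1.$$ The code $\mathcal C$ is $r$-MSRD if $r$ is attached to some such $h$ and $d_r(\mathcal C)=h$. **Theorem.** Let $\mathcal C\subseteq\mathbb M$ be a non-trivial code with $\dim\mathcal C=\sum_{i=j}^{\ell}m_in_i-\delta m_j$, where $1\le j\le\ell$ and $0\le\delta\le n_j-1$. Let $d_{\max}\le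 h\le n$, let $k=k(h)$, and let $r$ be the integer attached to $h$. Suppose that $\mathcal C$ is $r$-MSRD. Then $$d_r(\mathcal C)=d_{r+1}(\mathcal C)=\dots=d_{r+m_k-1}(\mathcal C)=h.$$ Moreover, if $h<n$, then $\mathcal C$ is $(r+m_k)$-MSRD, while if $h=n$, then $r+m_k-1=\dim\mathcal C$. Consequently, for every $h\le h'\le n$ with attached integer $r'$ and $k'=k(h')$, the code $\mathcal C$ is $r'$-MSRD and $d_{r'}(\mathcal C)=\dots=d_{r'+m_{k'}-1}(\mathcal C)=h'$. -/

import Mathlib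

/-- The ambient space `F^{m_1 × n_1} × ⋯ × F^{m_ℓ × n_ℓ}`. -/
abbrev SumRankSpace {ℓ : ℕ} (m n : Fin ℓ → ℕ) (F : Type*) : Type _ :=
  (i : Fin ℓ) → Matrix (Fin (m i)) (Fin (n i)) F

namespace SumRank

/-- `maxrk(A)`, the largest rank of a matrix in a rank-metric code (a linear space of matrices). -/
noncomputable def maxRk {F : Type*} [Field F] {a b : ℕ}
    (A : Submodule F (Matrix (Fin a) (Fin b) F)) : ℕ :=
  sSup {w : ℕ | ∃ X ∈ A, X.rank = w}

/-- An optimal rank-metric anticode in `F^{a × b}` (with `b ≤ a`): `dim A = a * maxrk(A)`. -/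
def IsOptimalAnticode {F : Type*} [Field F] {a b : ℕ}
    (A : Submodule F (Matrix (Fin a) (Fin b) F)) : Prop :=
  Module.finrank F A = a * maxRk A

variable {ℓ : ℕ} {m n : Fin ℓ → ℕ} {F : Type*} [Field F]

/-- The sum-rank weight. -/
noncomputable def srk (X : SumRankSpace m n F) : ℕ := ∑ i, (X i).rank

/-- The maximum sum-rank distance of a code. -/
noncomputable def maxSrk (C : Submodule F (SumRankSpace m n F)) : ℕ :=
  sSup {w : ℕ | ∃ X ∈ C, srk X = w}

/-- `A = A_1 × ⋯ × A_ℓ` with every `A_i` an optimal rank-metric anticode. -/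
def IsProductAnticode (A : Submodule F (SumRankSpace m n F)) : Prop :=
  ∃ B : (i : Fin ℓ) → Submodule F (Matrix (Fin (m i)) (Fin (n i)) F),
    (∀ i, IsOptimalAnticode (B i)) ∧ A = Submodule.pi Set.univ B

/-- The `r`-th generalized sum-rank weight `d_r(C)`, meaningful for `1 ≤ r ≤ dim C`
(for `r > dim C` the set is empty and the value is `0`). -/
noncomputable def genWeight (C : Submodule F (SumRankSpace m n F)) (r : ℕ) : ℕ :=
  sInf {w : ℕ | ∃ A : Submodule F (SumRankSpace m n F),
    IsProductAnticode A ∧ r ≤ Module.finrank F ↥(C ⊓ A) ∧ maxSrk A = w}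

/-- `r_μ`: the largest dimension of a product of optimal rank-metric anticodes whose maximum
sum-rank is `μ`. -/
noncomputable def maxAnticodeDim (m n : Fin ℓ → ℕ) (F : Type*) [Field F] (μ : ℕ) : ℕ :=
  sSup {D : ℕ | ∃ A : Submodule F (SumRankSpace m n F),
    IsProductAnticode A ∧ maxSrk A = μ ∧ Module.finrank F A = D}

/-- `k = max {ν | n_1 + ⋯ + n_{ν-1} < h}`. -/
def IsBlockOf (n : Fin ℓ → ℕ) (h : ℕ) (k : Fin ℓ) : Prop :=
  IsGreatest {ν : Fin ℓ | ∑ i ∈ Finset.Iio ν, n i < h} k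

/-- `dim C = ∑_{i ≥ j} m_i n_i - δ m_j`, with `0 ≤ δ ≤ n_j - 1`. -/
def HasDimForm (C : Submodule F (SumRankSpace m n F)) (j : Fin ℓ) (δ : ℕ) : Prop :=
  δ < n j ∧ Module.finrank F C + δ * m j = ∑ i ∈ Finset.Ici j, m i * n i

/-- `d_max = n_1 + ⋯ + n_{j-1} + δ + 1`. -/
def dMax (n : Fin ℓ → ℕ) (j : Fin ℓ) (δ : ℕ) : ℕ := ∑ i ∈ Finset.Iio j, n i + δ + 1

/-- `d_max ≤ h ≤ n`, `k = max {ν | n_1 + ⋯ + n_{ν-1} < h}` and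
`r = r_h - r_{d_max - 1} - m_k + 1` (written without subtractions of `r`'s). -/
def IsAttached (m n : Fin ℓ → ℕ) (F : Type*) [Field F] (d h : ℕ) (k : Fin ℓ) (r : ℕ) : Prop :=
  d ≤ h ∧ h ≤ ∑ i, n i ∧ IsBlockOf n h k ∧
    r + maxAnticodeDim m n F (d - 1) + m k = maxAnticodeDim m n F h + 1

/-- `C` is `r`-MSRD. -/
def IsRMSRD (C : Submodule F (SumRankSpace m n F)) (r : ℕ) : Prop :=
  ∃ (j : Fin ℓ) (δ : ℕ) (h : ℕ) (k : Fin ℓ),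
    HasDimForm C j δ ∧ IsAttached m n F (dMax n j δ) h k r ∧ genWeight C r = h

end SumRank

/-! Write `d` for d_max. The dimension of `C` is complementary to r_{d-1}: dim C + r_{d-1} = dim M.
A product anticode of maximum sum-rank h and of largest dimension r_h therefore meets `C` in
dimension at least r_h - r_{d-1}, so d_s(C) ≤ h for all s ≤ r_h - r_{d-1}. Since r_h = r_{h-1} +
m_k, the integer r attached to h is the first index not covered by the bound for h-1, and r + m_k -
1 is the last one covered by the bound for h. If d_r(C) = h, monotonicity makes the weights constant
on this interval. For h = n the interval ends at dim M - r_{d-1} = dim C.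

For h < n, the weight has to jump at r + m_k. If it were still h, a product anticode A of maximum
sum-rank h would meet `C` in dimension at least r + m_k. As h exceeds the total width of the blocks
before k, some factor of A in a block i ≥ k is nonzero. Replacing it by an optimal anticode inside
it with maximum rank one less costs dimension m_i ≤ m_k and leaves an intersection with `C` of
dimension at least r, so d_r(C) ≤ h - 1, a contradiction. Induction on h then gives the propagation.

The nontrivial input is that a nonzero optimal anticode contains one of maximum rank one less
(`BoundedRank.exists_sub`). It follows from the equality case of the Flanders–Meshulam bound: an
extremal space of rank at most r contains all maps with a prescribed kernel or all maps with a
prescribed range. Both are proved through the fibres of S, which record the rank-one maps φ ⊗ x : v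
↦ φ v • x lying in S. -/

namespace BoundedRank

open Module

set_option linter.unusedSectionVars false

universe u v w

/-! ### Rank-one maps, fibres and compression -/

variable {K : Type u} {V : Type v} {W : Type w} [Field K]
  [AddCommGroup V] [Module K V] [AddCommGroup W] [Module K W]

/-- Every member of `S` has rank at most `r`. -/
def RankLE (S : Submodule K (V →ₗ[K] W)) (r : ℕ) : Prop :=
  ∀ f ∈ S, finrank K (LinearMap.range f) ≤ r

/-- The functionals `φ` such that the rank-one map `v ↦ φ v • x` belongs to `S`. -/
def fiber (S : Submodule K (V →ₗ[K] W)) (x : W) : Submodule K (Dual K V) :=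
  S.comap (LinearMap.smulRightₗ.flip x)

theorem mem_fiber {S : Submodule K (V →ₗ[K] W)} {x : W} {φ : Dual K V} :
    φ ∈ fiber S x ↔ φ.smulRight x ∈ S := Iff.rfl

theorem exists_dual_eq_one {x : W} (hx : x ≠ 0) : ∃ ψ : Dual K W, ψ x = 1 := by
  obtain ⟨f, hf⟩ := Projective.exists_dual_ne_zero K hx
  exact ⟨(f x)⁻¹ • f, by simp [hf]⟩

theorem exists_apply_eq_one {φ : Dual K V} (hφ : φ ≠ 0) : ∃ e, φ e = 1 := by
  obtain ⟨v, hv⟩ : ∃ v, φ v ≠ 0 := by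
    by_contra! h
    exact hφ (LinearMap.ext h)
  exact ⟨(φ v)⁻¹ • v, by simp [hv]⟩

theorem eq_smulRight_of_range_le {x : W} (hx : x ≠ 0) {g : V →ₗ[K] W}
    (hg : LinearMap.range g ≤ K ∙ x) : ∃ φ : Dual K V, g = φ.smulRight x := by
  obtain ⟨ψ, hψ⟩ := exists_dual_eq_one (K := K) hx
  refine ⟨ψ ∘ₗ g, LinearMap.ext fun y => ?_⟩
  obtain ⟨c, hc⟩ := Submodule.mem_span_singleton.1 (hg ⟨y, rfl⟩)
  simp [← hc, hψ]

section Finite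

variable [FiniteDimensional K V] [FiniteDimensional K W]

theorem finrank_map_add_finrank_inf_ker {E E' : Type*} [AddCommGroup E] [Module K E]
    [AddCommGroup E'] [Module K E'] (L : E →ₗ[K] E') (P : Submodule K E)
    [FiniteDimensional K P] :
    finrank K (P.map L) + finrank K ↥(P ⊓ LinearMap.ker L) = finrank K P := by
  have h := LinearMap.finrank_range_add_finrank_ker (L.domRestrict P)
  rw [LinearMap.range_domRestrict, LinearMap.ker_domRestrict] at h
  rw [← h, ← Submodule.map_comap_subtype]
  congr 1
  exact (Submodule.equivMapOfInjective _ P.subtype_injective _).finrank_eq.symm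

/-- A vector of `ker f` on which `φ` does not vanish is sent to a nonzero multiple of `x`. The new
range thus contains `x`, and with it all of `range f`. -/
theorem rank_lt_rank_add_smulRight {f : V →ₗ[K] W} {x : W} (hx : x ∉ LinearMap.range f)
    {φ : Dual K V} (hφ : φ ∉ (LinearMap.ker f).dualAnnihilator) :
    finrank K (LinearMap.range f) < finrank K (LinearMap.range (f + φ.smulRight x)) := by
  rw [Submodule.mem_dualAnnihilator] at hφ
  push Not at hφ
  obtain ⟨v, hv, hv0⟩ := hφ
  have hxm : x ∈ LinearMap.range (f + φ.smulRight x) :=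
    ⟨(φ v)⁻¹ • v, by simp [LinearMap.mem_ker.1 hv, hv0]⟩
  refine Submodule.finrank_lt_finrank_of_lt (lt_of_le_of_ne ?_ fun h => hx (h ▸ hxm))
  rintro _ ⟨y, rfl⟩
  have : f y = (f + φ.smulRight x) y - φ y • x := by simp
  rw [this]
  exact sub_mem ⟨y, rfl⟩ (Submodule.smul_mem _ _ hxm)

theorem finrank_dualAnnihilator_ker (f : V →ₗ[K] W) :
    finrank K (LinearMap.ker f).dualAnnihilator = finrank K (LinearMap.range f) := by
  have h1 := Subspace.finrank_add_finrank_dualAnnihilator_eq (LinearMap.ker f)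
  have h2 := LinearMap.finrank_range_add_finrank_ker f
  omega

theorem fiber_le_of_rank_eq {S : Submodule K (V →ₗ[K] W)} {r : ℕ} (hS : RankLE S r)
    {f : V →ₗ[K] W} (hf : f ∈ S) (hr : finrank K (LinearMap.range f) = r) {x : W}
    (hx : x ∉ LinearMap.range f) : fiber S x ≤ (LinearMap.ker f).dualAnnihilator := by
  intro φ hφ
  by_contra h
  have h1 := rank_lt_rank_add_smulRight hx h
  have h2 := hS _ (S.add_mem hf (mem_fiber.1 hφ))
  omega

theorem exists_notMem_range {f : V →ₗ[K] W} (hf : finrank K (LinearMap.range f) < finrank K W) :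
    ∃ x, x ∉ LinearMap.range f := by
  by_contra! h
  rw [(Submodule.eq_top_iff' (p := LinearMap.range f)).2 h, finrank_top] at hf
  exact hf.false

/-- A space with all ranks less than `dim W` and whose fibres all have dimension at least `k`
contains a map of rank at least `k`. -/
theorem exists_le_rank {S : Submodule K (V →ₗ[K] W)} {r : ℕ} (hS : RankLE S r)
    (hrW : r < finrank K W) {k : ℕ} (hk : ∀ x ≠ 0, k ≤ finrank K (fiber S x)) :
    ∃ f ∈ S, k ≤ finrank K (LinearMap.range f) := by
  induction k with
  | zero => exact ⟨0, S.zero_mem, Nat.zero_le _⟩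
  | succ k ih =>
    obtain ⟨f, hf, hfk⟩ := ih fun x hx => (Nat.le_succ k).trans (hk x hx)
    rcases hfk.lt_or_eq with h | h
    · exact ⟨f, hf, h⟩
    obtain ⟨x, hx⟩ := exists_notMem_range ((hS f hf).trans_lt hrW)
    have hx0 : x ≠ 0 := fun h0 => hx (h0 ▸ Submodule.zero_mem _)
    -- The fibre has dimension at least `k + 1`, whereas the annihilator of `ker f` has dimension
    -- `k`, the rank of `f`.
    obtain ⟨φ, hφ, hφ'⟩ : ∃ φ ∈ fiber S x, φ ∉ (LinearMap.ker f).dualAnnihilator := by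
      by_contra! hle
      have h1 := Submodule.finrank_mono (R := K) (s := fiber S x) hle
      rw [finrank_dualAnnihilator_ker] at h1
      have := hk x hx0
      omega
    have := rank_lt_rank_add_smulRight hx hφ'
    exact ⟨_, S.add_mem hf (mem_fiber.1 hφ), by omega⟩

theorem exists_finrank_fiber_le {S : Submodule K (V →ₗ[K] W)} {r : ℕ} (hS : RankLE S r)
    (hrW : r < finrank K W) : ∃ x ≠ 0, finrank K (fiber S x) ≤ r := by
  by_contra! h
  obtain ⟨f, hf, hfr⟩ := exists_le_rank hS hrW h
  have := hS f hf
  omega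

theorem finrank_quotient_span_singleton {x : W} (hx : x ≠ 0) :
    finrank K (W ⧸ (K ∙ x)) + 1 = finrank K W := by
  have := (K ∙ x).finrank_quotient_add_finrank
  rwa [finrank_span_singleton hx] at this

theorem finrank_ker_dual {φ : Dual K V} (hφ : φ ≠ 0) :
    finrank K (LinearMap.ker φ) + 1 = finrank K V := by
  have := LinearMap.finrank_range_add_finrank_ker φ
  obtain ⟨e, he⟩ := exists_apply_eq_one hφ
  rw [LinearMap.range_eq_top.2 fun c => ⟨c • e, by simp [he]⟩, finrank_top, finrank_self] at this
  omega

theorem rank_comp_le {W' : Type*} [AddCommGroup W'] [Module K W'] (g : W →ₗ[K] W')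
    (f : V →ₗ[K] W) : finrank K (LinearMap.range (g ∘ₗ f)) ≤ finrank K (LinearMap.range f) := by
  rw [LinearMap.range_comp]
  exact Submodule.finrank_map_le _ _

/-- Post-composition with the quotient map by the line through `x`. -/
noncomputable def quot (x : W) : (V →ₗ[K] W) →ₗ[K] (V →ₗ[K] W ⧸ (K ∙ x)) :=
  LinearMap.compRight K (K ∙ x).mkQ

theorem quot_apply (x : W) (f : V →ₗ[K] W) : quot x f = (K ∙ x).mkQ ∘ₗ f := rfl

theorem rankLE_map_quot {S : Submodule K (V →ₗ[K] W)} {r : ℕ} (hS : RankLE S r) (x : W) :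
    RankLE (S.map (quot x)) r := by
  rintro _ ⟨f, hf, rfl⟩
  exact (rank_comp_le _ _).trans (hS f hf)

theorem range_le_of_quot_eq_zero {x : W} {f : V →ₗ[K] W} (h : quot x f = 0) :
    LinearMap.range f ≤ K ∙ x := by
  rintro _ ⟨y, rfl⟩
  have := LinearMap.congr_fun h y
  simpa [quot_apply] using this

/-- A map killed by the quotient takes values in the line of `x`, so it has the form φ ⊗ x with φ in
the fibre. -/
theorem finrank_map_quot {S : Submodule K (V →ₗ[K] W)} {x : W} (hx : x ≠ 0)
    (h : fiber S x = ⊥) : finrank K (S.map (quot x)) = finrank K S := by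
  rw [← finrank_map_add_finrank_inf_ker (quot x) S, left_eq_add, Submodule.finrank_eq_zero,
    eq_bot_iff]
  rintro f ⟨hf, hf0⟩
  obtain ⟨φ, rfl⟩ := eq_smulRight_of_range_le hx (range_le_of_quot_eq_zero hf0)
  have : φ ∈ fiber S x := hf
  rw [h, Submodule.mem_bot] at this
  simp [this]

/-- Restriction to the kernel of `φ` followed by the quotient by the line through `x`. -/
noncomputable def compress (φ : Dual K V) (x : W) :
    (V →ₗ[K] W) →ₗ[K] (LinearMap.ker φ →ₗ[K] W ⧸ (K ∙ x)) :=
  LinearMap.lcomp K _ (LinearMap.ker φ).subtype ∘ₗ quot x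

theorem compress_apply (φ : Dual K V) (x : W) (f : V →ₗ[K] W) :
    compress φ x f = (K ∙ x).mkQ ∘ₗ (f ∘ₗ (LinearMap.ker φ).subtype) := rfl

/-- If all maps `f + c • φ ⊗ x` have rank at most `r`, then compressing `f` lowers the rank. -/
theorem rank_compress_lt {S : Submodule K (V →ₗ[K] W)} {r : ℕ} (hS : RankLE S r) {x : W}
    (hx : x ≠ 0) {φ : Dual K V} (hφ : φ ≠ 0) (hφS : φ.smulRight x ∈ S) {f : V →ₗ[K] W}
    (hf : f ∈ S) : finrank K (LinearMap.range (compress φ x f)) < r := by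
  rw [compress_apply, LinearMap.range_comp]
  set R := LinearMap.range (f ∘ₗ (LinearMap.ker φ).subtype) with hR
  have hRf : ∀ g ∈ S, (∀ y ∈ LinearMap.ker φ, g y = f y) → R ≤ LinearMap.range g := by
    rintro g - hg _ ⟨y, rfl⟩
    exact ⟨y, hg y y.2⟩
  by_cases hxR : x ∈ R
  · have h1 := finrank_map_add_finrank_inf_ker (K ∙ x).mkQ R
    have h2 : 0 < finrank K ↥(R ⊓ LinearMap.ker (K ∙ x).mkQ) := by
      rw [Nat.pos_iff_ne_zero, Ne, Submodule.finrank_eq_zero, Submodule.eq_bot_iff]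
      push Not
      exact ⟨x, ⟨hxR, by simp⟩, hx⟩
    have h3 := (Submodule.finrank_mono (hRf f hf fun _ _ => rfl)).trans (hS f hf)
    omega
  -- If `x ∉ R`, then `f e` and `f e + x` cannot both lie in `R`, so `f` or `f + φ ⊗ x` has range
  -- strictly larger than `R`.
  · obtain ⟨e, he⟩ := exists_apply_eq_one hφ
    have key : ∃ g ∈ S, (∀ y ∈ LinearMap.ker φ, g y = f y) ∧ g e ∉ R := by
      by_cases h : f e ∈ R
      · refine ⟨f + φ.smulRight x, S.add_mem hf hφS, fun y hy => ?_, fun h' => hxR ?_⟩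
        · simp [LinearMap.mem_ker.1 hy]
        · simpa [he] using R.sub_mem h' h
      · exact ⟨f, hf, fun _ _ => rfl, h⟩
    obtain ⟨g, hg, hgf, hge⟩ := key
    have hlt : R < LinearMap.range g :=
      lt_of_le_of_ne (hRf g hg hgf) fun h => hge (h ▸ LinearMap.mem_range_self g e)
    exact (Submodule.finrank_map_le _ _).trans_lt
      ((Submodule.finrank_lt_finrank_of_lt hlt).trans_le (hS g hg))

/-- A map killed by the compression sends `ker φ` into the line of `x`. It is determined modulo that
line by its value at a vector `e` with `φ e = 1`, which costs dim W - 1; if this value also lies in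
the line, the map is φ' ⊗ x with φ' in the fibre. -/
theorem finrank_le_compress {S : Submodule K (V →ₗ[K] W)} {x : W} (hx : x ≠ 0)
    {φ : Dual K V} (hφ : φ ≠ 0) :
    finrank K S + 1 ≤
      finrank K (S.map (compress φ x)) + finrank K W + finrank K (fiber S x) := by
  obtain ⟨e, he⟩ := exists_apply_eq_one hφ
  have h1 := finrank_map_add_finrank_inf_ker (compress φ x) S
  set N := S ⊓ LinearMap.ker (compress φ x)
  let ev : (V →ₗ[K] W) →ₗ[K] W ⧸ (K ∙ x) := (K ∙ x).mkQ ∘ₗ LinearMap.applyₗ e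
  have h2 := finrank_map_add_finrank_inf_ker ev N
  have h3 := Submodule.finrank_le (N.map ev)
  have h4 := finrank_quotient_span_singleton (K := K) hx
  have h5 : N ⊓ LinearMap.ker ev ≤ (fiber S x).map (LinearMap.smulRightₗ.flip x) := by
    rintro g ⟨⟨hgS, hgK⟩, hge⟩
    have hge' : g e ∈ K ∙ x := by simpa [ev] using hge
    have hg : LinearMap.range g ≤ K ∙ x := by
      rintro _ ⟨y, rfl⟩
      have hy : y - φ y • e ∈ LinearMap.ker φ := by simp [he]
      have h6 := LinearMap.congr_fun (LinearMap.mem_ker.1 hgK) ⟨_, hy⟩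
      have h7 : g (y - φ y • e) ∈ K ∙ x := by
        rw [← Submodule.Quotient.mk_eq_zero]
        exact h6
      rw [map_sub, map_smul] at h7
      simpa using add_mem h7 (Submodule.smul_mem _ (φ y) hge')
    obtain ⟨ψ, rfl⟩ := eq_smulRight_of_range_le hx hg
    exact ⟨ψ, hgS, rfl⟩
  have h6 : _ ≤ finrank K (fiber S x) :=
    (Submodule.finrank_mono h5).trans (Submodule.finrank_map_le _ _)
  omega

end Finite

/-! ### The Flanders–Meshulam bound -/

/-- The Flanders–Meshulam bound: a space of linear maps of rank at most `r` between spaces of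
dimension at most `N` has dimension at most `N * r`. -/
theorem finrank_le_mul : ∀ (d : ℕ) (V : Type v) (W : Type w) [AddCommGroup V] [Module K V]
    [AddCommGroup W] [Module K W] [FiniteDimensional K V] [FiniteDimensional K W]
    (S : Submodule K (V →ₗ[K] W)) (r N : ℕ), finrank K W = d → finrank K V ≤ N →
    finrank K W ≤ N → RankLE S r → finrank K S ≤ N * r := by
  intro d
  induction d with
  | zero =>
    intro V W _ _ _ _ _ _ S r N hd hV hW hS
    have := S.finrank_le
    rw [finrank_linearMap, hd] at this
    omega
  | succ d ih =>
    intro V W _ _ _ _ _ _ S r N hd hV hW hS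
    rcases le_or_gt (d + 1) r with hr | hr
    · refine S.finrank_le.trans ?_
      rw [finrank_linearMap, hd]
      exact Nat.mul_le_mul hV hr
    obtain ⟨x, hx, hxr⟩ := exists_finrank_fiber_le hS (hd ▸ hr)
    have hq := finrank_quotient_span_singleton (K := K) hx
    -- A trivial fibre lets the line of `x` be divided out without loss of dimension. Otherwise
    -- compression lowers both the rank bound and `N` by one, at a cost of at most `N - 1 + r`, and
    -- (N - 1)(r - 1) + N - 1 + r = N r.
    by_cases hb : fiber S x = ⊥
    · rw [← finrank_map_quot hx hb]
      exact ih V (W ⧸ (K ∙ x)) _ r N (by omega) hV (by omega) (rankLE_map_quot hS x)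
    · obtain ⟨φ, hφ, hφ0⟩ := (Submodule.ne_bot_iff _).1 hb
      have hk := finrank_ker_dual hφ0
      have hr0 : 0 < r := by
        have := rank_compress_lt hS hx hφ0 hφ S.zero_mem
        omega
      obtain ⟨r, rfl⟩ := Nat.exists_eq_succ_of_ne_zero hr0.ne'
      obtain ⟨N, rfl⟩ := Nat.exists_eq_succ_of_ne_zero (show N ≠ 0 by omega)
      have h1 := ih (LinearMap.ker φ) (W ⧸ (K ∙ x)) (S.map (compress φ x)) r N (by omega)
        (by omega) (by omega) (by
          rintro _ ⟨f, hf, rfl⟩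
          exact Nat.lt_succ_iff.1 (rank_compress_lt hS hx hφ0 hφ hf))
      have h2 := finrank_le_compress (S := S) hx hφ0
      have h3 : N.succ * r.succ = N * r + N + r + 1 := by
        simp only [Nat.succ_eq_add_one]; ring
      omega

/-! ### The equality case of the bound -/

variable [FiniteDimensional K V] [FiniteDimensional K W]

/-- A bounded-rank space of maximal dimension with no trivial fibre contains all the maps
vanishing on a fixed subspace of codimension `r`. -/
theorem exists_fiber_eq_bot_or_exists_ker {S : Submodule K (V →ₗ[K] W)} {r : ℕ}
    (hS : RankLE S r) (hVW : finrank K V ≤ finrank K W) (hr : r < finrank K W)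
    (hdim : finrank K S = finrank K W * r) :
    (∃ x ≠ 0, fiber S x = ⊥) ∨
      ∃ f ∈ S, finrank K (LinearMap.range f) = r ∧
        ∀ g : V →ₗ[K] W, LinearMap.ker f ≤ LinearMap.ker g → g ∈ S := by
  refine or_iff_not_imp_left.2 fun hne => ?_
  push Not at hne
  -- Equality in the bound leaves no slack in the compression inequality, so every nonzero fibre
  -- already has dimension at least `r`.
  have hd : ∀ x ≠ 0, r ≤ finrank K (fiber S x) := by
    intro x hx
    obtain ⟨φ, hφ, hφ0⟩ := (Submodule.ne_bot_iff _).1 (hne x hx)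
    have hr0 : 0 < r := by
      have := rank_compress_lt hS hx hφ0 hφ S.zero_mem
      omega
    have hk := finrank_ker_dual hφ0
    have hq := finrank_quotient_span_singleton (K := K) hx
    obtain ⟨r, rfl⟩ := Nat.exists_eq_succ_of_ne_zero hr0.ne'
    obtain ⟨N, hN⟩ := Nat.exists_eq_succ_of_ne_zero (show finrank K W ≠ 0 by omega)
    have h1 := finrank_le_mul _ (LinearMap.ker φ) (W ⧸ (K ∙ x)) (S.map (compress φ x)) r N rfl
      (by omega) (by omega) (by
        rintro _ ⟨f, hf, rfl⟩
        exact Nat.lt_succ_iff.1 (rank_compress_lt hS hx hφ0 hφ hf))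
    have h2 := finrank_le_compress (S := S) hx hφ0
    have h3 : N.succ * r.succ = N * r + N + r + 1 := by
      simp only [Nat.succ_eq_add_one]; ring
    rw [hdim, hN] at h2
    omega
  obtain ⟨f, hf, hfr⟩ := exists_le_rank hS hr hd
  have hfr : finrank K (LinearMap.range f) = r := le_antisymm (hS f hf) hfr
  have hfib : ∀ x ∉ LinearMap.range f, fiber S x = (LinearMap.ker f).dualAnnihilator := by
    intro x hx
    have hx0 : x ≠ 0 := fun h0 => hx (h0 ▸ Submodule.zero_mem _)
    refine Submodule.eq_of_le_of_finrank_le (fiber_le_of_rank_eq hS hf hfr hx) ?_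
    rw [finrank_dualAnnihilator_ker, hfr]
    exact hd x hx0
  -- Fibres are known only off `range f`; a point `x` of the range is reached as the difference of
  -- `x + z` and `z`, both outside it.
  obtain ⟨z, hz⟩ := exists_notMem_range (hfr.trans_lt hr)
  have hall : ∀ x, ∀ φ ∈ (LinearMap.ker f).dualAnnihilator, φ.smulRight x ∈ S := by
    intro x φ hφ
    by_cases hx : x ∈ LinearMap.range f
    · have h1 : φ ∈ fiber S z := by rwa [hfib z hz]
      have hxz : x + z ∉ LinearMap.range f := fun h => hz (by simpa using sub_mem h hx)
      have h2 : φ ∈ fiber S (x + z) := by rwa [hfib _ hxz]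
      have h3 := S.sub_mem (mem_fiber.1 h2) (mem_fiber.1 h1)
      convert h3 using 1
      ext y
      simp
    · have h1 : φ ∈ fiber S x := by rwa [hfib x hx]
      exact h1
  refine ⟨f, hf, hfr, fun g hg => ?_⟩
  let b := finBasis K W
  have hsum : g = ∑ i, ((b.coord i) ∘ₗ g).smulRight (b i) := by
    ext y
    simp only [LinearMap.sum_apply, LinearMap.smulRight_apply, LinearMap.comp_apply,
      Basis.coord_apply]
    exact (b.sum_repr (g y)).symm
  rw [hsum]
  refine S.sum_mem fun i _ => hall _ _ ?_
  rw [Submodule.mem_dualAnnihilator]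
  intro y hy
  simp [LinearMap.mem_ker.1 (hg hy)]

/-- A trivial fibre would let S embed into the maps to a space of dimension dim W - 1, still at
least dim V, where the bound (dim W - 1) r is too small. -/
theorem exists_ker_of_finrank_lt {S : Submodule K (V →ₗ[K] W)} {r : ℕ} (hS : RankLE S r)
    (hVW : finrank K V < finrank K W) (hr0 : 0 < r) (hr : r < finrank K W)
    (hdim : finrank K S = finrank K W * r) :
    ∃ f ∈ S, finrank K (LinearMap.range f) = r ∧
      ∀ g : V →ₗ[K] W, LinearMap.ker f ≤ LinearMap.ker g → g ∈ S := by
  refine (exists_fiber_eq_bot_or_exists_ker hS hVW.le hr hdim).resolve_left ?_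
  rintro ⟨x, hx, hb⟩
  have hq := finrank_quotient_span_singleton (K := K) hx
  have h1 := finrank_le_mul _ V (W ⧸ (K ∙ x)) _ r (finrank K W - 1) rfl (by omega) (by omega)
    (rankLE_map_quot hS x)
  rw [finrank_map_quot hx hb, hdim] at h1
  have := Nat.le_of_mul_le_mul_right h1 hr0
  omega

/-! ### Transposition and the square case -/

/-- The space of transposes of the members of `S`. -/
noncomputable def transpose (S : Submodule K (V →ₗ[K] W)) :
    Submodule K (Dual K W →ₗ[K] Dual K V) :=
  S.map Dual.transpose

theorem transpose_injective :
    Function.Injective (Dual.transpose : (V →ₗ[K] W) →ₗ[K] (Dual K W →ₗ[K] Dual K V)) := by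
  refine (injective_iff_map_eq_zero _).2 fun f hf => ?_
  ext v
  rw [LinearMap.zero_apply, ← forall_dual_apply_eq_zero_iff K]
  intro ψ
  exact LinearMap.congr_fun (LinearMap.congr_fun hf ψ) v

theorem dualMap_mem_transpose {S : Submodule K (V →ₗ[K] W)} {f : V →ₗ[K] W} :
    f.dualMap ∈ transpose S ↔ f ∈ S :=
  ⟨fun ⟨_, hg, h⟩ => transpose_injective h ▸ hg, fun h => ⟨f, h, rfl⟩⟩

theorem finrank_transpose (S : Submodule K (V →ₗ[K] W)) :
    finrank K (transpose S) = finrank K S :=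
  (Submodule.equivMapOfInjective _ transpose_injective S).finrank_eq.symm

theorem rankLE_transpose {S : Submodule K (V →ₗ[K] W)} {r : ℕ} (hS : RankLE S r) :
    RankLE (transpose S) r := by
  rintro _ ⟨f, hf, rfl⟩
  have h := hS f hf
  rwa [← LinearMap.finrank_range_dualMap_eq_finrank_range] at h

theorem exists_range_of_exists_ker_transpose {S : Submodule K (V →ₗ[K] W)} {r : ℕ}
    (h : ∃ f ∈ transpose S, finrank K (LinearMap.range f) = r ∧
      ∀ g, LinearMap.ker f ≤ LinearMap.ker g → g ∈ transpose S) :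
    ∃ f ∈ S, finrank K (LinearMap.range f) = r ∧
      ∀ g : V →ₗ[K] W, LinearMap.range g ≤ LinearMap.range f → g ∈ S := by
  obtain ⟨_, ⟨f, hf, rfl⟩, hr, hg⟩ := h
  refine ⟨f, hf, ?_, fun g hgf => dualMap_mem_transpose.1 (hg _ ?_)⟩
  · rw [← LinearMap.finrank_range_dualMap_eq_finrank_range]
    exact hr
  · change LinearMap.ker f.dualMap ≤ LinearMap.ker g.dualMap
    rw [LinearMap.ker_dualMap_eq_dualAnnihilator_range,
      LinearMap.ker_dualMap_eq_dualAnnihilator_range]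
    exact Submodule.dualAnnihilator_anti hgf

theorem exists_range_of_finrank_lt {S : Submodule K (V →ₗ[K] W)} {r : ℕ} (hS : RankLE S r)
    (hVW : finrank K W < finrank K V) (hr0 : 0 < r) (hr : r < finrank K V)
    (hdim : finrank K S = finrank K V * r) :
    ∃ f ∈ S, finrank K (LinearMap.range f) = r ∧
      ∀ g : V →ₗ[K] W, LinearMap.range g ≤ LinearMap.range f → g ∈ S :=
  exists_range_of_exists_ker_transpose <|
    exists_ker_of_finrank_lt (rankLE_transpose hS) (by simpa [Subspace.dual_finrank_eq] using hVW)
      hr0 (by simpa [Subspace.dual_finrank_eq] using hr)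
      (by rw [finrank_transpose, hdim, Subspace.dual_finrank_eq])

/-- This is the dichotomy for the transposed space: a trivial fibre of the transpose at `φ` says
that S contains no nonzero map φ ⊗ y. -/
theorem exists_functional_or_exists_range {S : Submodule K (V →ₗ[K] W)} {r : ℕ}
    (hS : RankLE S r) (hVW : finrank K W ≤ finrank K V) (hr : r < finrank K V)
    (hdim : finrank K S = finrank K V * r) :
    (∃ φ : Dual K V, φ ≠ 0 ∧ ∀ y : W, φ.smulRight y ∈ S → y = 0) ∨
    ∃ f ∈ S, finrank K (LinearMap.range f) = r ∧
      ∀ g : V →ₗ[K] W, LinearMap.range g ≤ LinearMap.range f → g ∈ S := by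
  refine (exists_fiber_eq_bot_or_exists_ker (rankLE_transpose hS)
    (by simpa [Subspace.dual_finrank_eq] using hVW)
    (by simpa [Subspace.dual_finrank_eq] using hr)
    (by rw [finrank_transpose, hdim, Subspace.dual_finrank_eq])).imp ?_
    exists_range_of_exists_ker_transpose
  rintro ⟨φ, hφ, hb⟩
  refine ⟨φ, hφ, fun y hy => ?_⟩
  have h1 : Dual.eval K W y ∈ fiber (transpose S) φ := by
    rw [mem_fiber]
    convert dualMap_mem_transpose.2 hy using 1
    ext ψ v
    simp [mul_comm]
  rw [hb, Submodule.mem_bot] at h1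
  exact (forall_dual_apply_eq_zero_iff K y).1 fun ψ => LinearMap.congr_fun h1 ψ

/-- There is a map with a prescribed range which takes a prescribed value at `y` and vanishes at
a vector `v` independent of `y`. -/
theorem exists_range_eq (W₁ : Submodule K W) {w : W} (hw : w ∈ W₁) (hw0 : w ≠ 0)
    {v y : V} (hv : v ≠ 0) (hy : y ∉ K ∙ v) (hV : finrank K W₁ < finrank K V) :
    ∃ P : V →ₗ[K] W, LinearMap.range P = W₁ ∧ P v = 0 ∧ P y = w := by
  obtain ⟨ψ, hψ⟩ := exists_dual_eq_one (K := K) hw0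
  obtain ⟨χ, hχ0, hχ⟩ := Submodule.exists_dual_map_eq_bot_of_notMem hy inferInstance
  have hχv : χ v = 0 := by
    have : χ v ∈ (K ∙ v).map χ := ⟨v, Submodule.mem_span_singleton_self v, rfl⟩
    rwa [hχ, Submodule.mem_bot] at this
  set W₂ := W₁ ⊓ LinearMap.ker ψ
  have h1 : W₂ < W₁ := lt_of_le_of_ne inf_le_left fun h => by
    have : w ∈ W₂ := h ▸ hw
    simp [W₂, hψ] at this
  have h2 := Submodule.finrank_lt_finrank_of_lt h1
  set U := (K ∙ v) ⊔ (K ∙ y)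
  have h3 := U.finrank_quotient_add_finrank
  have h4 : finrank K U = 1 + 1 := by
    rw [Submodule.finrank_sup_span_singleton hy, finrank_span_singleton hv]
  -- Both `v` and `y` are to be killed by the part of the map onto `W₂`, so it factors through `V ⧸
  -- U`, of dimension dim V - 2 ≥ dim W₁ - 1 ≥ dim W₂. The functional `χ` supplies the value `w` at
  -- `y`.
  obtain ⟨i, hi⟩ := finrank_le_iff_exists_linearMap.1
    (show finrank K W₂ ≤ finrank K (V ⧸ U) by omega)
  obtain ⟨p, hp⟩ := LinearMap.exists_leftInverse_of_injective i (LinearMap.ker_eq_bot.2 hi)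
  let Q : V →ₗ[K] W := W₂.subtype ∘ₗ p ∘ₗ U.mkQ
  have hQU : ∀ z ∈ U, Q z = 0 := fun z hz => by
    simp [Q, (Submodule.Quotient.mk_eq_zero U).2 hz]
  have hQv : Q v = 0 := hQU v (Submodule.mem_sup_left (Submodule.mem_span_singleton_self v))
  have hQy : Q y = 0 := hQU y (Submodule.mem_sup_right (Submodule.mem_span_singleton_self y))
  let P : V →ₗ[K] W := ((χ y)⁻¹ • χ).smulRight w + Q
  have hPy : P y = w := by simp [P, hQy, hχ0]
  refine ⟨P, le_antisymm ?_ fun z hz => ?_, by simp [P, hQv, hχv], hPy⟩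
  · rintro _ ⟨z, rfl⟩
    exact W₁.add_mem (W₁.smul_mem _ hw) (p (U.mkQ z)).2.1
  · have hz2 : z - ψ z • w ∈ W₂ := ⟨W₁.sub_mem hz (W₁.smul_mem _ hw), by simp [hψ]⟩
    obtain ⟨t, ht⟩ := U.mkQ_surjective (i ⟨_, hz2⟩)
    have hQt : Q t = z - ψ z • w := by
      have := LinearMap.congr_fun hp ⟨_, hz2⟩
      simp only [LinearMap.comp_apply, LinearMap.id_apply] at this
      simp [Q, ht, this]
    have hPt : P t = ((χ y)⁻¹ * χ t) • w + (z - ψ z • w) := by simp [P, hQt]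
    have : z = P (t - ((χ y)⁻¹ * χ t) • y + ψ z • y) := by
      rw [map_add, map_sub, map_smul, map_smul, hPy, hPt]
      abel
    exact ⟨_, this.symm⟩

/-- When the quotient map has the full rank `r`, rank-nullity forces the inclusion of `ker f` in its
kernel to be an equality. -/
theorem ker_quot_eq {S : Submodule K (V →ₗ[K] W)} {r : ℕ} (hS : RankLE S r) {x : W}
    {f : V →ₗ[K] W} (hf : f ∈ S) (hr : r ≤ finrank K (LinearMap.range (quot x f))) {v : V}
    (hv : quot x f v = 0) : f v = 0 := by
  have h1 : LinearMap.ker f ≤ LinearMap.ker (quot x f) := LinearMap.ker_le_ker_comp _ _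
  have h2 := LinearMap.finrank_range_add_finrank_ker f
  have h3 := LinearMap.finrank_range_add_finrank_ker (quot x f)
  have h4 := hS f hf
  have h5 := Submodule.eq_of_le_of_finrank_le h1 (by omega)
  have : v ∈ LinearMap.ker f := h5 ▸ hv
  exact this

/-- If `S` lifts all the maps into an `r`-dimensional subspace of the quotient by a line, then it
contains rank-one maps with any given kernel hyperplane. -/
theorem exists_smulRight_mem {S : Submodule K (V →ₗ[K] W)} {r : ℕ} (hS : RankLE S r) {x : W}
    (W₁ : Submodule K (W ⧸ (K ∙ x))) (hW₁ : finrank K W₁ = r) (hr0 : 0 < r)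
    (hr : r < finrank K V)
    (hlift : ∀ g : V →ₗ[K] W ⧸ (K ∙ x), LinearMap.range g ≤ W₁ → g ∈ S.map (quot x))
    {φ : Dual K V} (hφ : φ ≠ 0) : ∃ y : W, y ≠ 0 ∧ φ.smulRight y ∈ S := by
  obtain ⟨w, hw, hw0⟩ : ∃ w ∈ W₁, w ≠ 0 := by
    refine (Submodule.ne_bot_iff _).1 fun h => ?_
    rw [h, finrank_bot] at hW₁
    omega
  obtain ⟨e, he⟩ := exists_apply_eq_one hφ
  have hrange : LinearMap.range (φ.smulRight w) ≤ W₁ := by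
    rintro _ ⟨z, rfl⟩
    exact W₁.smul_mem _ hw
  obtain ⟨s, hs, hsw⟩ := hlift _ hrange
  -- The lift `s` of φ ⊗ w need not have full rank in the quotient. If `r > 1`, it is the difference
  -- of two lifts, `p + s` and `p`, that do and whose quotients kill `v`; hence both kill `v`.
  have hker : ∀ v, φ v = 0 → s v = 0 := by
    intro v hφv
    by_cases hv0 : v = 0
    · simp [hv0]
    by_cases hr1 : r = 1
    · refine ker_quot_eq (x := x) hS hs ?_ (by simp [hsw, hφv])
      rw [hr1, hsw, Submodule.one_le_finrank_iff, Submodule.ne_bot_iff]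
      exact ⟨w, ⟨e, by simp [he]⟩, hw0⟩
    · obtain ⟨y, hy, hyv⟩ : ∃ y ∈ LinearMap.ker φ, y ∉ K ∙ v := by
        by_contra! hle
        have h1 := Submodule.finrank_mono (R := K) (s := LinearMap.ker φ) hle
        rw [finrank_span_singleton hv0] at h1
        have h2 := finrank_ker_dual hφ
        omega
      have hφy : φ y = 0 := hy
      obtain ⟨P, hPr, hPv, hPy⟩ := exists_range_eq W₁ hw hw0 hv0 hyv (hW₁ ▸ hr)
      obtain ⟨p, hp, hpP⟩ := hlift P hPr.le
      have h1 : p v = 0 := ker_quot_eq hS hp (by rw [hpP, hPr, hW₁]) (by rw [hpP, hPv])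
      have h2 : (p + s) v = 0 := by
        refine ker_quot_eq (x := x) hS (S.add_mem hp hs) ?_ (by simp [map_add, hpP, hsw, hPv, hφv])
        rw [map_add, hpP, hsw, ← hW₁, ← hPr]
        refine Submodule.finrank_mono ?_
        rintro _ ⟨z, rfl⟩
        exact ⟨z - φ z • y, by simp [hPy, hφy]⟩
      simpa [h1] using h2
  have hse : s = φ.smulRight (s e) := by
    ext z
    have := hker (z - φ z • e) (by simp [he])
    rw [map_sub, map_smul, sub_eq_zero] at this
    simpa using this
  refine ⟨s e, fun h0 => hw0 ?_, hse ▸ hs⟩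
  have h1 := LinearMap.congr_fun hsw e
  rw [quot_apply, LinearMap.comp_apply, h0, map_zero] at h1
  simpa [he] using h1.symm

/-- A space of linear maps of rank at most `r` and of the maximal dimension allowed by the
Flanders–Meshulam bound consists of all the maps with prescribed kernel or prescribed range. -/
theorem exists_ker_or_exists_range {S : Submodule K (V →ₗ[K] W)} {r : ℕ} (hS : RankLE S r)
    (hVW : finrank K V ≤ finrank K W) (hr0 : 0 < r) (hr : r < finrank K W)
    (hdim : finrank K S = finrank K W * r) :
    (∃ f ∈ S, finrank K (LinearMap.range f) = r ∧
      ∀ g : V →ₗ[K] W, LinearMap.ker f ≤ LinearMap.ker g → g ∈ S) ∨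
    (finrank K V = finrank K W ∧ ∃ f ∈ S, finrank K (LinearMap.range f) = r ∧
      ∀ g : V →ₗ[K] W, LinearMap.range g ≤ LinearMap.range f → g ∈ S) := by
  rcases hVW.lt_or_eq with h | h
  · exact Or.inl (exists_ker_of_finrank_lt hS h hr0 hr hdim)
  rcases exists_fiber_eq_bot_or_exists_ker hS hVW hr hdim with ⟨x, hx, hb⟩ | h1
  -- If both S and its transpose had a trivial fibre, dividing out `x` would give an extremal space
  -- with target smaller than `V`. It contains all maps into some `r`-dimensional subspace; lifting
  -- produces a nonzero φ ⊗ y in S, contradicting the trivial fibre of the transpose.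
  · refine Or.inr ⟨h, (exists_functional_or_exists_range hS h.ge (h ▸ hr)
      (h ▸ hdim)).resolve_left ?_⟩
    rintro ⟨φ, hφ, hφS⟩
    have hq := finrank_quotient_span_singleton (K := K) hx
    obtain ⟨f, -, hfr, hf⟩ := exists_range_of_finrank_lt (rankLE_map_quot hS x) (by omega) hr0
      (h ▸ hr) (by rw [finrank_map_quot hx hb, hdim, h])
    obtain ⟨y, hy0, hy⟩ := exists_smulRight_mem hS (LinearMap.range f) hfr hr0 (h ▸ hr) hf hφ
    exact hy0 (hφS y hy)
  · exact Or.inl h1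

/-! ### Lowering the rank inside an extremal space -/

theorem finrank_ker_lcomp_subtype (U : Submodule K V) :
    finrank K (LinearMap.ker (LinearMap.lcomp K W U.subtype)) + finrank K U * finrank K W =
      finrank K V * finrank K W := by
  have h := LinearMap.finrank_range_add_finrank_ker (LinearMap.lcomp K W U.subtype)
  have h2 : LinearMap.range (LinearMap.lcomp K W U.subtype) = ⊤ :=
    LinearMap.range_eq_top.2 fun g => LinearMap.exists_extend g
  rw [h2, finrank_top, finrank_linearMap, finrank_linearMap] at h
  omega

theorem mem_ker_lcomp_subtype {U : Submodule K V} {f : V →ₗ[K] W} :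
    f ∈ LinearMap.ker (LinearMap.lcomp K W U.subtype) ↔ U ≤ LinearMap.ker f := by
  refine ⟨fun h y hy => LinearMap.congr_fun h ⟨y, hy⟩, fun h => LinearMap.ext fun y => h y.2⟩

/-- A space containing all the maps that vanish on `U` contains all those that vanish on `U` and
one further vector. -/
theorem exists_sub_of_ker {S : Submodule K (V →ₗ[K] W)} {r : ℕ} {U : Submodule K V}
    (hU : finrank K U + (r + 1) = finrank K V)
    (h : ∀ g : V →ₗ[K] W, U ≤ LinearMap.ker g → g ∈ S) :
    ∃ T ≤ S, finrank K T = finrank K W * r ∧ RankLE T r := by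
  obtain ⟨v, hv⟩ : ∃ v, v ∉ U := by
    by_contra! hv
    rw [(Submodule.eq_top_iff' (p := U)).2 hv, finrank_top] at hU
    omega
  have hU' := Submodule.finrank_sup_span_singleton hv
  refine ⟨LinearMap.ker (LinearMap.lcomp K W (U ⊔ K ∙ v).subtype), fun g hg => h g ?_, ?_, ?_⟩
  · exact le_sup_left.trans (mem_ker_lcomp_subtype.1 hg)
  · have h1 := finrank_ker_lcomp_subtype (W := W) (U ⊔ K ∙ v)
    have h2 : finrank K V = finrank K ↥(U ⊔ K ∙ v) + r := by omega
    rw [h2, add_mul] at h1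
    rw [mul_comm]
    omega
  · intro g hg
    have h1 := Submodule.finrank_mono (mem_ker_lcomp_subtype.1 hg)
    have h2 := LinearMap.finrank_range_add_finrank_ker g
    omega

theorem exists_sub_of_range {S : Submodule K (V →ₗ[K] W)} {r : ℕ} {W₁ : Submodule K W}
    (hW₁ : finrank K W₁ = r + 1)
    (h : ∀ g : V →ₗ[K] W, LinearMap.range g ≤ W₁ → g ∈ S) :
    ∃ T ≤ S, finrank K T = finrank K V * r ∧ RankLE T r := by
  obtain ⟨i, hi⟩ := finrank_le_iff_exists_linearMap.1
    (show finrank K (Fin r → K) ≤ finrank K W₁ by simp [hW₁])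
  let L : (V →ₗ[K] (Fin r → K)) →ₗ[K] (V →ₗ[K] W) := LinearMap.compRight K (W₁.subtype ∘ₗ i)
  have hL : Function.Injective L := by
    intro f g hfg
    ext1 v
    exact hi (W₁.subtype_injective (LinearMap.congr_fun hfg v))
  refine ⟨LinearMap.range L, ?_, ?_, ?_⟩
  · rintro _ ⟨f, rfl⟩
    refine h _ ?_
    rintro _ ⟨v, rfl⟩
    exact (i (f v)).2
  · rw [LinearMap.finrank_range_of_inj hL, finrank_linearMap]
    simp
  · rintro _ ⟨f, rfl⟩
    refine (rank_comp_le (W₁.subtype ∘ₗ i) f).trans ((LinearMap.range f).finrank_le.trans ?_)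
    simp

/-- A bounded-rank space of maximal dimension contains one whose rank bound is smaller by one. -/
theorem exists_sub {S : Submodule K (V →ₗ[K] W)} {r : ℕ} (hS : RankLE S (r + 1))
    (hVW : finrank K V ≤ finrank K W) (hdim : finrank K S = finrank K W * (r + 1)) :
    ∃ T ≤ S, finrank K T = finrank K W * r ∧ RankLE T r := by
  rcases Nat.eq_zero_or_pos (finrank K W) with h0 | h0
  · refine ⟨⊥, bot_le, by simp [h0], fun f hf => ?_⟩
    rw [(Submodule.mem_bot K).1 hf, LinearMap.range_zero, finrank_bot]
    exact Nat.zero_le _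
  have h1 := S.finrank_le
  rw [hdim, finrank_linearMap, mul_comm] at h1
  have h2 : r + 1 ≤ finrank K V := Nat.le_of_mul_le_mul_right h1 h0
  rcases (h2.trans hVW).lt_or_eq with hr | hr
  · rcases exists_ker_or_exists_range hS hVW r.succ_pos hr hdim with
      ⟨f, -, hf, h⟩ | ⟨hVW', f, -, hf, h⟩
    · refine exists_sub_of_ker ?_ h
      have := LinearMap.finrank_range_add_finrank_ker f
      omega
    · rw [← hVW']
      exact exists_sub_of_range hf h
  -- The classification needs `r + 1 < dim W`. In the remaining case dim V = dim W = r + 1 and S is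
  -- everything, that is, all maps vanishing on the zero subspace.
  · have hV : finrank K V = r + 1 := by omega
    have htop : S = ⊤ := Submodule.eq_top_of_finrank_eq (by
      rw [hdim, finrank_linearMap, hV, mul_comm])
    exact exists_sub_of_ker (U := ⊥) (by simp [hV]) fun g _ => htop ▸ Submodule.mem_top

end BoundedRank

namespace SumRank

open Module

/-! ### Optimal rank-metric anticodes -/

section Anticode

variable {F : Type*} [Field F] {a b : ℕ}

theorem bddAbove_ranks (A : Submodule F (Matrix (Fin a) (Fin b) F)) :
    BddAbove {w : ℕ | ∃ X ∈ A, X.rank = w} :=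
  ⟨b, by rintro _ ⟨X, -, rfl⟩; exact X.rank_le_width⟩

theorem rank_le_maxRk {A : Submodule F (Matrix (Fin a) (Fin b) F)} {X} (hX : X ∈ A) :
    X.rank ≤ maxRk A :=
  le_csSup (bddAbove_ranks A) ⟨X, hX, rfl⟩

theorem exists_rank_eq_maxRk (A : Submodule F (Matrix (Fin a) (Fin b) F)) :
    ∃ X ∈ A, X.rank = maxRk A :=
  Nat.sSup_mem (s := {w : ℕ | ∃ X ∈ A, X.rank = w}) ⟨_, 0, A.zero_mem, rfl⟩ (bddAbove_ranks A)

theorem maxRk_le {A : Submodule F (Matrix (Fin a) (Fin b) F)} {r : ℕ}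
    (h : ∀ X ∈ A, X.rank ≤ r) : maxRk A ≤ r := by
  obtain ⟨X, hX, hr⟩ := exists_rank_eq_maxRk A
  exact hr ▸ h X hX

theorem maxRk_le_width (A : Submodule F (Matrix (Fin a) (Fin b) F)) : maxRk A ≤ b :=
  maxRk_le fun X _ => X.rank_le_width

theorem rankLE_map_toLin' {A : Submodule F (Matrix (Fin a) (Fin b) F)} {r : ℕ} :
    BoundedRank.RankLE (A.map (Matrix.toLin' : Matrix (Fin a) (Fin b) F ≃ₗ[F] _).toLinearMap) r ↔
      ∀ X ∈ A, X.rank ≤ r := by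
  constructor
  · exact fun h X hX => h _ ⟨X, hX, rfl⟩
  · rintro h _ ⟨X, hX, rfl⟩
    exact h X hX

theorem finrank_le_mul_maxRk (hba : b ≤ a) (A : Submodule F (Matrix (Fin a) (Fin b) F)) :
    finrank F A ≤ a * maxRk A := by
  rw [← LinearEquiv.finrank_map_eq Matrix.toLin' A]
  exact BoundedRank.finrank_le_mul _ _ _ _ _ _ rfl (by simpa using hba) (by simp)
    (rankLE_map_toLin'.2 fun X hX => rank_le_maxRk hX)

/-- The dimension bound forces the rank `r` to be attained. The hypothesis `r ≤ b` settles `a = 0`,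
where the dimension carries no information. -/
theorem eq_maxRk_of_finrank_eq (hba : b ≤ a) {A : Submodule F (Matrix (Fin a) (Fin b) F)} {r : ℕ}
    (hdim : finrank F A = a * r) (hr : r ≤ b) (h : ∀ X ∈ A, X.rank ≤ r) : maxRk A = r := by
  refine le_antisymm (maxRk_le h) ?_
  rcases Nat.eq_zero_or_pos a with ha | ha
  · omega
  · exact Nat.le_of_mul_le_mul_left (hdim ▸ finrank_le_mul_maxRk hba A) ha

theorem isOptimalAnticode_of_finrank_eq (hba : b ≤ a)
    {A : Submodule F (Matrix (Fin a) (Fin b) F)} {r : ℕ} (hdim : finrank F A = a * r)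
    (hr : r ≤ b) (h : ∀ X ∈ A, X.rank ≤ r) : IsOptimalAnticode A := by
  rw [IsOptimalAnticode, eq_maxRk_of_finrank_eq hba hdim hr h, hdim]

/-- Every nonzero optimal anticode contains an optimal anticode of maximum rank one less. -/
theorem IsOptimalAnticode.exists_sub (hba : b ≤ a) {A : Submodule F (Matrix (Fin a) (Fin b) F)}
    (hA : IsOptimalAnticode A) {r : ℕ} (hr : maxRk A = r + 1) :
    ∃ B ≤ A, IsOptimalAnticode B ∧ maxRk B = r := by
  have hrb : r ≤ b := by
    have := maxRk_le_width A
    omega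
  let e : Matrix (Fin a) (Fin b) F ≃ₗ[F] _ := Matrix.toLin'
  obtain ⟨T, hTA, hdim, hT⟩ := BoundedRank.exists_sub (S := A.map e.toLinearMap) (r := r)
    (rankLE_map_toLin'.2 fun X hX => hr ▸ rank_le_maxRk hX) (by simpa using hba)
    (by rw [LinearEquiv.finrank_map_eq, hA, hr]; simp)
  obtain ⟨B, rfl⟩ : ∃ B, B.map e.toLinearMap = T :=
    ⟨T.comap e.toLinearMap, Submodule.map_comap_eq_of_surjective e.surjective T⟩
  rw [LinearEquiv.finrank_map_eq, finrank_fin_fun] at hdim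
  have hB := rankLE_map_toLin'.1 hT
  exact ⟨B, (Submodule.map_le_map_iff_of_injective e.injective _ _).1 hTA,
    isOptimalAnticode_of_finrank_eq hba hdim hrb hB, eq_maxRk_of_finrank_eq hba hdim hrb hB⟩

theorem isOptimalAnticode_top (hba : b ≤ a) :
    IsOptimalAnticode (⊤ : Submodule F (Matrix (Fin a) (Fin b) F)) ∧
      maxRk (⊤ : Submodule F (Matrix (Fin a) (Fin b) F)) = b := by
  have hdim : finrank F (⊤ : Submodule F (Matrix (Fin a) (Fin b) F)) = a * b := by
    rw [finrank_top, finrank_matrix]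
    simp
  exact ⟨isOptimalAnticode_of_finrank_eq hba hdim le_rfl fun X _ => X.rank_le_width,
    eq_maxRk_of_finrank_eq hba hdim le_rfl fun X _ => X.rank_le_width⟩

theorem exists_isOptimalAnticode (F : Type*) [Field F] (hba : b ≤ a) {r : ℕ} (hr : r ≤ b) :
    ∃ A : Submodule F (Matrix (Fin a) (Fin b) F), IsOptimalAnticode A ∧ maxRk A = r := by
  induction hr using Nat.decreasingInduction with
  | self => exact ⟨⊤, isOptimalAnticode_top hba⟩
  | of_succ r _ ih =>
    obtain ⟨A, hA, hr⟩ := ih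
    obtain ⟨B, -, hB⟩ := hA.exists_sub hba hr
    exact ⟨B, hB⟩

end Anticode

/-! ### Products of optimal anticodes -/

variable {ℓ : ℕ} {m n : Fin ℓ → ℕ} {F : Type*} [Field F]

theorem bddAbove_srks (C : Submodule F (SumRankSpace m n F)) :
    BddAbove {w : ℕ | ∃ X ∈ C, srk X = w} :=
  ⟨∑ i, n i, by
    rintro _ ⟨X, -, rfl⟩
    exact Finset.sum_le_sum fun i _ => (X i).rank_le_width⟩

theorem maxSrk_pi (B : (i : Fin ℓ) → Submodule F (Matrix (Fin (m i)) (Fin (n i)) F)) :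
    maxSrk (Submodule.pi Set.univ B) = ∑ i, maxRk (B i) := by
  refine le_antisymm (csSup_le ⟨_, 0, Submodule.zero_mem _, rfl⟩ ?_) ?_
  · rintro _ ⟨X, hX, rfl⟩
    exact Finset.sum_le_sum fun i _ => rank_le_maxRk (hX i trivial)
  · choose X hX hXr using fun i => exists_rank_eq_maxRk (B i)
    exact le_csSup (bddAbove_srks _)
      ⟨X, fun i _ => hX i, Finset.sum_congr rfl fun i _ => hXr i⟩

theorem finrank_pi (B : (i : Fin ℓ) → Submodule F (Matrix (Fin (m i)) (Fin (n i)) F)) :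
    finrank F (Submodule.pi Set.univ B) = ∑ i, finrank F (B i) := by
  let e : Submodule.pi Set.univ B ≃ₗ[F] ((i : Fin ℓ) → B i) :=
    { toFun := fun X i => ⟨X.1 i, X.2 i trivial⟩
      invFun := fun X => ⟨fun i => X i, fun i _ => (X i).2⟩
      map_add' := fun _ _ => rfl
      map_smul' := fun _ _ => rfl
      left_inv := fun _ => rfl
      right_inv := fun _ => rfl }
  rw [e.finrank_eq, finrank_pi_fintype]

/-- A product anticode has a profile of maximum ranks which determines its invariants. -/
theorem finrank_pi_of_isOptimalAnticode
    {B : (i : Fin ℓ) → Submodule F (Matrix (Fin (m i)) (Fin (n i)) F)}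
    (hB : ∀ i, IsOptimalAnticode (B i)) :
    finrank F (Submodule.pi Set.univ B) = ∑ i, m i * maxRk (B i) :=
  (finrank_pi B).trans (Finset.sum_congr rfl fun i _ => hB i)

theorem exists_isProductAnticode (F : Type*) [Field F] (hnm : ∀ i, n i ≤ m i) {u : Fin ℓ → ℕ}
    (hu : ∀ i, u i ≤ n i) :
    ∃ A : Submodule F (SumRankSpace m n F),
      IsProductAnticode A ∧ maxSrk A = ∑ i, u i ∧ finrank F A = ∑ i, m i * u i := by
  choose B hB hBu using fun i => exists_isOptimalAnticode F (hnm i) (hu i)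
  refine ⟨_, ⟨B, hB, rfl⟩, ?_, ?_⟩
  · simp [maxSrk_pi, hBu]
  · simp [finrank_pi_of_isOptimalAnticode hB, hBu]

theorem isProductAnticode_top (hnm : ∀ i, n i ≤ m i) :
    IsProductAnticode (⊤ : Submodule F (SumRankSpace m n F)) :=
  ⟨fun _ => ⊤, fun i => (isOptimalAnticode_top (hnm i)).1, by ext; simp⟩

theorem finrank_sumRankSpace : finrank F (SumRankSpace m n F) = ∑ i, m i * n i := by
  rw [finrank_pi_fintype]
  simp [finrank_matrix]

/-! ### Greedy profiles and the numbers r_μ -/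

/-- The profile filling the blocks before `k` and `e` columns of block `k`. -/
def greedyProfile (n : Fin ℓ → ℕ) (k : Fin ℓ) (e : ℕ) (i : Fin ℓ) : ℕ :=
  if i < k then n i else if i = k then e else 0

theorem sum_greedyProfile (n f : Fin ℓ → ℕ) (k : Fin ℓ) (e : ℕ) :
    ∑ i, f i * greedyProfile n k e i = ∑ i ∈ Finset.Iio k, f i * n i + f k * e := by
  have h : ∀ i, f i * greedyProfile n k e i =
      (if i ∈ Finset.Iio k then f i * n i else 0) + (if i = k then f k * e else 0) := by
    intro i
    rcases lt_trichotomy i k with h | h | h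
    · simp [greedyProfile, h, h.ne]
    · simp [greedyProfile, h]
    · simp [greedyProfile, h.not_gt, h.ne']
  simp_rw [h]
  rw [Finset.sum_add_distrib, Finset.sum_ite_mem]
  simp

/-- With g the greedy profile, (m_i - m_k)(g_i - u_i) ≥ 0 for every i: both factors are nonnegative
before block `k` and nonpositive after it. Summing gives the claim because g and `u` have the same
total. -/
theorem sum_mul_le_of_antitone (hm : Antitone m) {u : Fin ℓ → ℕ} (hu : ∀ i, u i ≤ n i)
    {k : Fin ℓ} {e : ℕ} (hsum : ∑ i, u i = ∑ i ∈ Finset.Iio k, n i + e) :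
    ∑ i, m i * u i ≤ ∑ i ∈ Finset.Iio k, m i * n i + m k * e := by
  rw [← sum_greedyProfile]
  have h1 := sum_greedyProfile n (fun _ => 1) k e
  simp only [one_mul, ← hsum] at h1
  have h2 : ∀ i, m i * u i + m k * greedyProfile n k e i ≤
      m i * greedyProfile n k e i + m k * u i := by
    intro i
    rcases lt_trichotomy i k with h | h | h
    · simp only [greedyProfile, h, if_true]
      obtain ⟨c, hc⟩ := Nat.exists_eq_add_of_le (hm h.le)
      have := Nat.mul_le_mul_left c (hu i)
      rw [hc]
      linarith
    · simp [h, add_comm]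
    · simp only [greedyProfile, h.not_gt, h.ne', if_false, mul_zero, add_zero, zero_add]
      exact Nat.mul_le_mul_right _ (hm h.le)
  have h3 := Finset.sum_le_sum fun i (_ : i ∈ Finset.univ) => h2 i
  rw [Finset.sum_add_distrib, Finset.sum_add_distrib, ← Finset.mul_sum, ← Finset.mul_sum, h1] at h3
  omega

theorem exists_isProductAnticode_greedy (F : Type*) [Field F] (hnm : ∀ i, n i ≤ m i) {k : Fin ℓ}
    {e : ℕ} (he : e ≤ n k) :
    ∃ A : Submodule F (SumRankSpace m n F), IsProductAnticode A ∧
      maxSrk A = ∑ i ∈ Finset.Iio k, n i + e ∧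
      finrank F A = ∑ i ∈ Finset.Iio k, m i * n i + m k * e := by
  obtain ⟨A, hA, hs, hf⟩ := exists_isProductAnticode F hnm (u := greedyProfile n k e) (by
    intro i
    unfold greedyProfile
    split_ifs with h1 h2
    · exact le_rfl
    · exact h2 ▸ he
    · exact Nat.zero_le _)
  refine ⟨A, hA, ?_, by rw [hf, sum_greedyProfile]⟩
  rw [hs]
  simpa using sum_greedyProfile n (fun _ => 1) k e

theorem finrank_le_greedy (hm : Antitone m) {k : Fin ℓ} {e : ℕ}
    {A : Submodule F (SumRankSpace m n F)} (hA : IsProductAnticode A)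
    (hs : maxSrk A = ∑ i ∈ Finset.Iio k, n i + e) :
    finrank F A ≤ ∑ i ∈ Finset.Iio k, m i * n i + m k * e := by
  obtain ⟨B, hB, rfl⟩ := hA
  rw [finrank_pi_of_isOptimalAnticode hB]
  exact sum_mul_le_of_antitone hm (fun i => maxRk_le_width (B i)) (maxSrk_pi B ▸ hs)

/-- The case `e = n k` is allowed, so that two consecutive values of μ can be expressed with the
same block `k`. -/
theorem maxAnticodeDim_eq (F : Type*) [Field F] (hm : Antitone m) (hnm : ∀ i, n i ≤ m i)
    {k : Fin ℓ} {e : ℕ} (he : e ≤ n k) :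
    maxAnticodeDim m n F (∑ i ∈ Finset.Iio k, n i + e) =
      ∑ i ∈ Finset.Iio k, m i * n i + m k * e := by
  obtain ⟨A, hA, hs, hf⟩ := exists_isProductAnticode_greedy F hnm he
  refine IsGreatest.csSup_eq ⟨⟨A, hA, hs, hf⟩, ?_⟩
  rintro _ ⟨A', hA', hs', rfl⟩
  exact finrank_le_greedy hm hA' hs'

theorem exists_isBlockOf {h : ℕ} (hh : 0 < h) (j : Fin ℓ) : ∃ k, IsBlockOf n h k := by
  have hne : {ν : Fin ℓ | ∑ i ∈ Finset.Iio ν, n i < h}.Nonempty := by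
    refine ⟨⟨0, j.pos⟩, ?_⟩
    have : Finset.Iio (⟨0, j.pos⟩ : Fin ℓ) = ∅ := by
      ext i
      simp [Fin.lt_def]
    simpa [this] using hh
  obtain ⟨k, hk⟩ := (Set.toFinite _).exists_maximal hne
  exact ⟨k, hk.1, fun i hi => (le_total i k).elim id fun hki => hk.2 hi hki⟩

theorem IsBlockOf.le {h : ℕ} {k : Fin ℓ} (hk : IsBlockOf n h k) (hh : h ≤ ∑ i, n i) :
    h ≤ ∑ i ∈ Finset.Iio k, n i + n k := by
  by_contra! hlt
  rw [Finset.sum_Iio_add_eq_sum_Iic] at hlt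
  by_cases hkl : k.1 + 1 < ℓ
  · have hIio : Finset.Iio (⟨k.1 + 1, hkl⟩ : Fin ℓ) = Finset.Iic k := by
      ext i
      simp only [Finset.mem_Iio, Finset.mem_Iic, Fin.lt_def, Fin.le_def]
      omega
    have hmem : ∑ i ∈ Finset.Iio (⟨k.1 + 1, hkl⟩ : Fin ℓ), n i < h := by
      rw [hIio]
      exact hlt
    have := hk.2 hmem
    simp [Fin.le_def] at this
  · have hIic : Finset.Iic k = Finset.univ := by
      ext i
      simp only [Finset.mem_Iic, Finset.mem_univ, iff_true, Fin.le_def]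
      omega
    rw [hIic] at hlt
    omega

theorem IsBlockOf.exists_eq {h : ℕ} {k : Fin ℓ} (hk : IsBlockOf n (h + 1) k)
    (hh : h + 1 ≤ ∑ i, n i) : ∃ e, h = ∑ i ∈ Finset.Iio k, n i + e ∧ e + 1 ≤ n k := by
  have h1 : ∑ i ∈ Finset.Iio k, n i < h + 1 := hk.1
  have h2 := hk.le hh
  exact ⟨h - ∑ i ∈ Finset.Iio k, n i, by omega, by omega⟩

theorem maxAnticodeDim_succ (F : Type*) [Field F] (hm : Antitone m) (hnm : ∀ i, n i ≤ m i)
    {h : ℕ} {k : Fin ℓ} (hk : IsBlockOf n (h + 1) k) (hh : h + 1 ≤ ∑ i, n i) :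
    maxAnticodeDim m n F (h + 1) = maxAnticodeDim m n F h + m k := by
  obtain ⟨e, rfl, he⟩ := hk.exists_eq hh
  rw [add_assoc, maxAnticodeDim_eq F hm hnm he, maxAnticodeDim_eq F hm hnm (by omega)]
  ring

theorem exists_finrank_eq_maxAnticodeDim (F : Type*) [Field F] (hm : Antitone m)
    (hnm : ∀ i, n i ≤ m i) {h : ℕ} {k : Fin ℓ} (hk : IsBlockOf n (h + 1) k)
    (hh : h + 1 ≤ ∑ i, n i) :
    ∃ A : Submodule F (SumRankSpace m n F), IsProductAnticode A ∧ maxSrk A = h + 1 ∧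
      finrank F A = maxAnticodeDim m n F (h + 1) := by
  obtain ⟨e, rfl, he⟩ := hk.exists_eq hh
  rw [add_assoc, maxAnticodeDim_eq F hm hnm he]
  exact exists_isProductAnticode_greedy F hnm he

theorem maxAnticodeDim_lt (F : Type*) [Field F] (hm : Antitone m) (hn : ∀ i, 0 < n i)
    (hnm : ∀ i, n i ≤ m i) (j : Fin ℓ) {h h' : ℕ} (hlt : h < h') (hh : h' ≤ ∑ i, n i) :
    maxAnticodeDim m n F h < maxAnticodeDim m n F h' := by
  induction h', hlt using Nat.le_induction with
  | base =>
    obtain ⟨k, hk⟩ := exists_isBlockOf (n := n) h.succ_pos j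
    rw [Nat.succ_eq_add_one, maxAnticodeDim_succ F hm hnm hk hh]
    have := (hn k).trans_le (hnm k)
    omega
  | succ h' _ ih =>
    obtain ⟨k, hk⟩ := exists_isBlockOf (n := n) h'.succ_pos j
    rw [maxAnticodeDim_succ F hm hnm hk hh]
    have := ih (by omega)
    omega

theorem maxAnticodeDim_injOn (F : Type*) [Field F] (hm : Antitone m) (hn : ∀ i, 0 < n i)
    (hnm : ∀ i, n i ≤ m i) (j : Fin ℓ) {h h' : ℕ} (hh : h ≤ ∑ i, n i) (hh' : h' ≤ ∑ i, n i)
    (heq : maxAnticodeDim m n F h = maxAnticodeDim m n F h') : h = h' := by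
  rcases lt_trichotomy h h' with hlt | hlt | hlt
  · exact absurd heq (maxAnticodeDim_lt F hm hn hnm j hlt hh').ne
  · exact hlt
  · exact absurd heq (maxAnticodeDim_lt F hm hn hnm j hlt hh).ne'

theorem maxAnticodeDim_le (F : Type*) [Field F] (hm : Antitone m) (hn : ∀ i, 0 < n i)
    (hnm : ∀ i, n i ≤ m i) (j : Fin ℓ) {h h' : ℕ} (hle : h ≤ h') (hh : h' ≤ ∑ i, n i) :
    maxAnticodeDim m n F h ≤ maxAnticodeDim m n F h' := by
  rcases hle.lt_or_eq with h1 | h1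
  · exact (maxAnticodeDim_lt F hm hn hnm j h1 hh).le
  · rw [h1]

/-- The greedy profile for d_max - 1 fills the blocks before `j` and `δ` columns of block `j`, which
is exactly what the dimension of `C` leaves out. -/
theorem HasDimForm.finrank_add {C : Submodule F (SumRankSpace m n F)} {j : Fin ℓ} {δ : ℕ}
    (hC : HasDimForm C j δ) (hm : Antitone m) (hnm : ∀ i, n i ≤ m i) :
    finrank F C + maxAnticodeDim m n F (dMax n j δ - 1) = ∑ i, m i * n i := by
  obtain ⟨hδ, hdim⟩ := hC
  rw [dMax, Nat.add_sub_cancel, maxAnticodeDim_eq F hm hnm hδ.le]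
  have h : ∑ i, m i * n i = ∑ i ∈ Finset.Iio j, m i * n i + ∑ i ∈ Finset.Ici j, m i * n i := by
    rw [← Finset.sum_union (Finset.disjoint_left.2 fun i h1 h2 => by
      simp only [Finset.mem_Iio, Finset.mem_Ici] at h1 h2
      exact absurd h1 h2.not_gt)]
    refine Finset.sum_congr (Finset.ext fun i => ?_) fun _ _ => rfl
    simpa using lt_or_ge i j
  rw [h, ← hdim]
  ring

theorem maxAnticodeDim_top (F : Type*) [Field F] (hm : Antitone m) (hnm : ∀ i, n i ≤ m i)
    (j : Fin ℓ) : maxAnticodeDim m n F (∑ i, n i) = ∑ i, m i * n i := by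
  obtain ⟨k, hk⟩ : ∃ k : Fin ℓ, k.1 = ℓ - 1 := ⟨⟨ℓ - 1, by have := j.pos; omega⟩, rfl⟩
  have hlast : ∀ f : Fin ℓ → ℕ, ∑ i, f i = ∑ i ∈ Finset.Iio k, f i + f k := by
    intro f
    rw [Finset.sum_Iio_add_eq_sum_Iic]
    refine Finset.sum_congr (Finset.ext fun i => ?_) fun _ _ => rfl
    simp only [Finset.mem_Iic, Finset.mem_univ, true_iff, Fin.le_def]
    omega
  rw [hlast n, hlast fun i => m i * n i, maxAnticodeDim_eq F hm hnm le_rfl]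

/-! ### Generalized weights: upper bound and jumps -/

theorem exists_maxSrk_eq_genWeight (hnm : ∀ i, n i ≤ m i) {C : Submodule F (SumRankSpace m n F)}
    {r : ℕ} (hr : r ≤ finrank F C) :
    ∃ A : Submodule F (SumRankSpace m n F),
      IsProductAnticode A ∧ r ≤ finrank F ↥(C ⊓ A) ∧ maxSrk A = genWeight C r :=
  Nat.sInf_mem (s := {w : ℕ | ∃ A : Submodule F (SumRankSpace m n F),
    IsProductAnticode A ∧ r ≤ finrank F ↥(C ⊓ A) ∧ maxSrk A = w}) ⟨_, ⊤, isProductAnticode_top hnm, by rwa [inf_top_eq], rfl⟩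

theorem genWeight_le {C A : Submodule F (SumRankSpace m n F)} {r : ℕ} (hA : IsProductAnticode A)
    (hr : r ≤ finrank F ↥(C ⊓ A)) : genWeight C r ≤ maxSrk A :=
  Nat.sInf_le ⟨A, hA, hr, rfl⟩

/-- The bound on `s` cannot be dropped: beyond dim C the infimum of the empty set is 0. -/
theorem genWeight_mono (hnm : ∀ i, n i ≤ m i) {C : Submodule F (SumRankSpace m n F)} {r s : ℕ}
    (hrs : r ≤ s) (hs : s ≤ finrank F C) : genWeight C r ≤ genWeight C s := by
  obtain ⟨A, hA, hsA, hw⟩ := exists_maxSrk_eq_genWeight hnm hs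
  exact hw ▸ genWeight_le hA (hrs.trans hsA)

/-- The Singleton bound for generalized weights. -/
theorem genWeight_le_of_add_le (hm : Antitone m) (hnm : ∀ i, n i ≤ m i)
    {C : Submodule F (SumRankSpace m n F)} {j : Fin ℓ} {δ : ℕ} (hC : HasDimForm C j δ)
    {h s : ℕ} (hh : h + 1 ≤ ∑ i, n i)
    (hs : s + maxAnticodeDim m n F (dMax n j δ - 1) ≤ maxAnticodeDim m n F (h + 1)) :
    genWeight C s ≤ h + 1 := by
  obtain ⟨k, hk⟩ := exists_isBlockOf (n := n) h.succ_pos j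
  obtain ⟨A, hA, hsA, hf⟩ := exists_finrank_eq_maxAnticodeDim F hm hnm hk hh
  rw [← hsA]
  refine genWeight_le hA ?_
  have h1 := Submodule.finrank_sup_add_finrank_inf_eq C A
  have h2 := (C ⊔ A).finrank_le
  have h3 := hC.finrank_add hm hnm
  rw [finrank_sumRankSpace] at h2
  omega

/-- The quotient of C ∩ A by C ∩ A' embeds into A / A'. -/
theorem finrank_inf_le {E : Type*} [AddCommGroup E] [Module F E] [FiniteDimensional F E]
    (C : Submodule F E) {A' A : Submodule F E} (hle : A' ≤ A) :
    finrank F ↥(C ⊓ A) + finrank F A' ≤ finrank F ↥(C ⊓ A') + finrank F A := by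
  have h1 := Submodule.finrank_sup_add_finrank_inf_eq (C ⊓ A) A'
  have h2 : C ⊓ A ⊓ A' = C ⊓ A' := by rw [inf_assoc, inf_eq_right.2 hle]
  have h3 := Submodule.finrank_mono (sup_le inf_le_right hle : C ⊓ A ⊔ A' ≤ A)
  rw [h2] at h1
  omega

/-- A product anticode that does not fit into the blocks before `k` contains a product anticode of
maximum sum-rank one less and of codimension at most `m k`. -/
theorem IsProductAnticode.exists_sub (hm : Antitone m) (hnm : ∀ i, n i ≤ m i)
    {A : Submodule F (SumRankSpace m n F)} (hA : IsProductAnticode A) {h : ℕ} {k : Fin ℓ}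
    (hs : maxSrk A = h + 1) (hk : ∑ i ∈ Finset.Iio k, n i ≤ h) :
    ∃ A' ≤ A, IsProductAnticode A' ∧ maxSrk A' = h ∧ finrank F A ≤ finrank F A' + m k := by
  obtain ⟨B, hB, rfl⟩ := hA
  rw [maxSrk_pi] at hs
  -- If all factors from block `k` on were zero, the maximum sum-rank would be at most the total
  -- width of the earlier blocks, which is at most `h`.
  obtain ⟨i, hki, hi⟩ : ∃ i, k ≤ i ∧ maxRk (B i) ≠ 0 := by
    by_contra! hz
    have : ∑ i, maxRk (B i) ≤ ∑ i ∈ Finset.Iio k, n i := by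
      rw [← Finset.sum_subset (Finset.subset_univ (Finset.Iio k)) fun i _ hi => hz i (by
        simpa using hi)]
      exact Finset.sum_le_sum fun i _ => maxRk_le_width (B i)
    omega
  obtain ⟨r, hr⟩ := Nat.exists_eq_succ_of_ne_zero hi
  obtain ⟨B', hB'le, hB', hB'r⟩ := (hB i).exists_sub (hnm i) hr
  have hU : ∀ i', IsOptimalAnticode (Function.update B i B' i') := by
    intro i'
    rcases eq_or_ne i' i with rfl | hne
    · simpa using hB'
    · simpa [hne] using hB i'
  have hmk := hm hki
  have hsum : ∀ f : Fin ℓ → ℕ, ∑ i', f i' * maxRk (B i') =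
      ∑ i', f i' * maxRk (Function.update B i B' i') + f i := by
    intro f
    have hcongr : ∑ i' ∈ Finset.univ.erase i, f i' * maxRk (Function.update B i B' i') =
        ∑ i' ∈ Finset.univ.erase i, f i' * maxRk (B i') :=
      Finset.sum_congr rfl fun i' hi' => by
        rw [Function.update_of_ne (Finset.ne_of_mem_erase hi')]
    rw [← Finset.add_sum_erase _ _ (Finset.mem_univ i),
      ← Finset.add_sum_erase (a := i) _ (fun i' => f i' * maxRk (Function.update B i B' i'))
        (Finset.mem_univ i), hcongr, Function.update_self, hr, hB'r, Nat.succ_eq_add_one]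
    ring
  refine ⟨_, fun X hX i' _ => ?_, ⟨Function.update B i B', hU, rfl⟩, ?_, ?_⟩
  · have := hX i' trivial
    rcases eq_or_ne i' i with rfl | hne
    · exact hB'le (by simpa using this)
    · simpa [hne] using this
  · rw [maxSrk_pi]
    have := hsum fun _ => 1
    simp only [one_mul] at this
    omega
  · rw [finrank_pi_of_isOptimalAnticode hB, finrank_pi_of_isOptimalAnticode hU, hsum m]
    omega

/-- The next jump of the generalized weights occurs at most `m k` steps later, where `k` is the
block of the current weight. -/
theorem genWeight_lt_add (hm : Antitone m) (hnm : ∀ i, n i ≤ m i)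
    {C : Submodule F (SumRankSpace m n F)} {r h : ℕ} {k : Fin ℓ} (hr : genWeight C r = h + 1)
    (hk : ∑ i ∈ Finset.Iio k, n i ≤ h) (hrC : r + m k ≤ finrank F C) :
    h + 1 < genWeight C (r + m k) := by
  refine lt_of_le_of_ne (hr ▸ genWeight_mono hnm (Nat.le_add_right _ _) hrC) fun heq => ?_
  obtain ⟨A, hA, hrA, hw⟩ := exists_maxSrk_eq_genWeight hnm hrC
  obtain ⟨A', hle, hA', hs', hf⟩ := hA.exists_sub hm hnm (hw.trans heq.symm) hk
  have h1 := finrank_inf_le C hle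
  have h2 := genWeight_le (C := C) (r := r) hA' (by omega)
  omega

/-! ### Attached integers and propagation -/

theorem IsAttached.one_le {j : Fin ℓ} {δ h r : ℕ} {k : Fin ℓ}
    (hr : IsAttached m n F (dMax n j δ) h k r) : 1 ≤ h :=
  le_trans (by simp [dMax]) hr.1

/-- Since r_{h+1} = r_h + m_k, the block size cancels: the integer attached to `h + 1` is one more
than the last index covered by the Singleton bound for `h`. -/
theorem IsAttached.add_eq {j : Fin ℓ} {δ h r : ℕ} {k : Fin ℓ} (hm : Antitone m)
    (hnm : ∀ i, n i ≤ m i) (hr : IsAttached m n F (dMax n j δ) (h + 1) k r) :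
    r + maxAnticodeDim m n F (dMax n j δ - 1) = maxAnticodeDim m n F h + 1 := by
  obtain ⟨-, h2, h3, h4⟩ := hr
  rw [maxAnticodeDim_succ F hm hnm h3 h2] at h4
  omega

theorem isAttached_of_add_eq {j : Fin ℓ} {δ h r : ℕ} {k : Fin ℓ} (hm : Antitone m)
    (hnm : ∀ i, n i ≤ m i) (hh : h + 1 ≤ ∑ i, n i) (hd : dMax n j δ ≤ h + 1)
    (hk : IsBlockOf n (h + 1) k)
    (hr : r + maxAnticodeDim m n F (dMax n j δ - 1) = maxAnticodeDim m n F h + 1) :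
    IsAttached m n F (dMax n j δ) (h + 1) k r := by
  refine ⟨hd, hh, hk, ?_⟩
  rw [maxAnticodeDim_succ F hm hnm hk hh]
  omega

/-- Being `r`-MSRD provides its own `j`, `δ` and `h`. The number r_{d_max - 1} is fixed by dim C, so
`r` determines r_h, and strict monotonicity of μ ↦ r_μ recovers h. -/
theorem IsRMSRD.genWeight_eq (hm : Antitone m) (hn : ∀ i, 0 < n i) (hnm : ∀ i, n i ≤ m i)
    {C : Submodule F (SumRankSpace m n F)} {j : Fin ℓ} {δ : ℕ} (hdim : HasDimForm C j δ)
    {h : ℕ} {k : Fin ℓ} {r : ℕ} (hr : IsAttached m n F (dMax n j δ) (h + 1) k r)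
    (hC : IsRMSRD C r) : genWeight C r = h + 1 := by
  obtain ⟨j', δ', h', k', hdim', hr', hw⟩ := hC
  obtain ⟨h', rfl⟩ := Nat.exists_eq_add_of_le' hr'.one_le
  have h1 := hdim.finrank_add hm hnm
  have h2 := hdim'.finrank_add hm hnm
  have h3 := hr.add_eq hm hnm
  have h4 := hr'.add_eq hm hnm
  have h5 := hr.2.1
  have h6 := hr'.2.1
  rw [hw, maxAnticodeDim_injOn F hm hn hnm j (h := h') (h' := h) (by omega) (by omega) (by omega)]

/-- All the weights between two attached integers are constant. -/
theorem genWeight_add_eq (hm : Antitone m) (hn : ∀ i, 0 < n i) (hnm : ∀ i, n i ≤ m i)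
    {C : Submodule F (SumRankSpace m n F)} {j : Fin ℓ} {δ : ℕ} (hdim : HasDimForm C j δ)
    {h : ℕ} {k : Fin ℓ} {r : ℕ} (hr : IsAttached m n F (dMax n j δ) (h + 1) k r)
    (hw : genWeight C r = h + 1) {s : ℕ} (hs : s < m k) : genWeight C (r + s) = h + 1 := by
  have h1 := hdim.finrank_add hm hnm
  have h2 := hr.2.2.2
  have h3 := maxAnticodeDim_le F hm hn hnm j hr.2.1 le_rfl
  rw [maxAnticodeDim_top F hm hnm j] at h3
  refine le_antisymm (genWeight_le_of_add_le hm hnm hdim hr.2.1 (by omega)) ?_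
  exact hw ▸ genWeight_mono hnm (Nat.le_add_right _ _) (by omega)

theorem genWeight_add_eq_succ (hm : Antitone m) (hn : ∀ i, 0 < n i) (hnm : ∀ i, n i ≤ m i)
    {C : Submodule F (SumRankSpace m n F)} {j : Fin ℓ} {δ : ℕ} (hdim : HasDimForm C j δ)
    {h : ℕ} {k : Fin ℓ} {r : ℕ} (hr : IsAttached m n F (dMax n j δ) (h + 1) k r)
    (hw : genWeight C r = h + 1) (hlt : h + 1 + 1 ≤ ∑ i, n i) :
    (r + m k) + maxAnticodeDim m n F (dMax n j δ - 1) = maxAnticodeDim m n F (h + 1) + 1 ∧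
      genWeight C (r + m k) = h + 1 + 1 := by
  have h1 := hdim.finrank_add hm hnm
  have h2 := hr.2.2.2
  have h3 := maxAnticodeDim_lt F hm hn hnm j (Nat.lt_add_one (h + 1)) hlt
  have h4 := maxAnticodeDim_le F hm hn hnm j hlt le_rfl
  rw [maxAnticodeDim_top F hm hnm j] at h4
  refine ⟨by omega, le_antisymm (genWeight_le_of_add_le hm hnm hdim hlt (by omega)) ?_⟩
  exact genWeight_lt_add hm hnm hw (Nat.lt_succ_iff.1 hr.2.2.1.1) (by omega)

/-- The weight at an attached integer propagates to all the later attached integers. -/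
theorem genWeight_eq_of_le (hm : Antitone m) (hn : ∀ i, 0 < n i) (hnm : ∀ i, n i ≤ m i)
    {C : Submodule F (SumRankSpace m n F)} {j : Fin ℓ} {δ : ℕ} (hdim : HasDimForm C j δ)
    {h : ℕ} {k : Fin ℓ} {r : ℕ} (hr : IsAttached m n F (dMax n j δ) (h + 1) k r)
    (hw : genWeight C r = h + 1) {h' : ℕ} (hh : h ≤ h') {k' : Fin ℓ} {r' : ℕ}
    (hr' : IsAttached m n F (dMax n j δ) (h' + 1) k' r') : genWeight C r' = h' + 1 := by
  induction h', hh using Nat.le_induction generalizing k' r' with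
  | base =>
    have h1 := hr.add_eq hm hnm
    have h2 := hr'.add_eq hm hnm
    rw [show r' = r by omega, hw]
  | succ h' hle ih =>
    have h1 := hr.1
    have h2 := hr.add_eq hm hnm
    have h3 := hr'.add_eq hm hnm
    have h5 : h' + 1 + 1 ≤ ∑ i, n i := hr'.2.1
    have h4 := maxAnticodeDim_le F hm hn hnm j hle (by omega)
    obtain ⟨k₀, hk₀⟩ := exists_isBlockOf (n := n) h'.succ_pos j
    -- Attached integers differ by the corresponding differences of the r_μ; the truncated
    -- subtraction is genuine by `h4`.
    have hr₀ := isAttached_of_add_eq (F := F) (j := j) (δ := δ)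
      (r := r + (maxAnticodeDim m n F h' - maxAnticodeDim m n F h)) hm hnm (by omega)
      (by omega) hk₀ (by omega)
    obtain ⟨h6, h7⟩ := genWeight_add_eq_succ hm hn hnm hdim hr₀ (ih hr₀) h5
    rw [← h7]
    congr 1
    omega

end SumRank

theorem mainTheorem4 {F : Type*} [Field F] [Finite F] {ℓ : ℕ} (m n : Fin ℓ → ℕ)
    (hm : Antitone m) (hn : ∀ i, 0 < n i) (hnm : ∀ i, n i ≤ m i)
    (C : Submodule F (SumRankSpace m n F)) (hC0 : C ≠ ⊥) (hC1 : C ≠ ⊤)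
    (j : Fin ℓ) (δ : ℕ) (hdim : SumRank.HasDimForm C j δ)
    (h : ℕ) (k : Fin ℓ) (r : ℕ)
    (hr : SumRank.IsAttached m n F (SumRank.dMax n j δ) h k r)
    (hMSRD : SumRank.IsRMSRD C r) :
    (∀ s < m k, SumRank.genWeight C (r + s) = h) ∧
    (h < ∑ i, n i → SumRank.IsRMSRD C (r + m k)) ∧
    (h = ∑ i, n i → r + m k = Module.finrank F C + 1) ∧
    (∀ (h' : ℕ) (k' : Fin ℓ) (r' : ℕ), h ≤ h' →
      SumRank.IsAttached m n F (SumRank.dMax n j δ) h' k' r' →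
      SumRank.IsRMSRD C r' ∧ ∀ s < m k', SumRank.genWeight C (r' + s) = h') := by
  obtain ⟨h, rfl⟩ := Nat.exists_eq_add_of_le' hr.one_le
  have hw := hMSRD.genWeight_eq hm hn hnm hdim hr
  refine ⟨fun s hs => SumRank.genWeight_add_eq hm hn hnm hdim hr hw hs, fun hlt => ?_,
    fun heq => ?_, fun h' k' r' hh hr' => ?_⟩
  · obtain ⟨h1, h2⟩ := SumRank.genWeight_add_eq_succ hm hn hnm hdim hr hw hlt
    obtain ⟨k', hk'⟩ := SumRank.exists_isBlockOf (n := n) (h + 1).succ_pos j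
    exact ⟨j, δ, h + 1 + 1, k', hdim,
      SumRank.isAttached_of_add_eq hm hnm hlt (hr.1.trans (Nat.le_succ _)) hk' h1, h2⟩
  -- For h = n, r_n = dim M, so r + m_k - 1 = dim M - r_{d_max - 1} = dim C.
  · have h1 := hdim.finrank_add hm hnm
    have h2 := hr.2.2.2
    rw [heq, SumRank.maxAnticodeDim_top F hm hnm j] at h2
    omega
  · obtain ⟨h', rfl⟩ := Nat.exists_eq_add_of_le' hr'.one_le
    have hw' := SumRank.genWeight_eq_of_le hm hn hnm hdim hr hw (Nat.le_of_succ_le_succ hh) hr'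
    exact ⟨⟨j, δ, h' + 1, k', hdim, hr', hw'⟩,
      fun s hs => SumRank.genWeight_add_eq hm hn hnm hdim hr' hw' hs⟩
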